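/- **Setting.** Let $\mathcal X\subset\mathbb R^d$ and $\mathcal Y\subset\mathbb R$ be measurable, where $\mathcal X$ has finite Lebesgue measure and $\mathcal Y$ is bounded. Let $(\mathbf X,Y)\sim F$ have a density $f_{\mathbf X}(\mathbf x)\,f_{Y\mid\mathbf X}(y\mid\mathbf x)$ on $\mathcal X\times\mathcal Y$, with $\int_{\mathcal Y}f_{Y\mid\mathbf X}(y\mid\mathbf x)\,dy=1$ for almost every $\mathbf x\in\mathcal X$. Let $(\mathbf x_1,y_1),(\mathbf x_2,y_2),\dots$ be independent observations from $F$. For each $n\ge 1$ let $N=N(n)\ge 1$ with $N(n)\to\infty$. For each $n$ the range of each of the $d$ coordinates of $\mathcal X$ is divided into $\kappa=\kappa(n)$ disjoint (deterministic) intervals, which gives a partition of $\mathcal X$ into $K(n)=\kappa(n)^d$ cells $B_1,\dots,B_K$. For $\mathbf x\in\mathcal X$ let $B_{\mathbf x}=B_{\mathbf x}(n)$ be the cell containing $\mathbf x$. **Conditional support points.** Let $N_k$ be the number of indices $i\le N$ with $\mathbf x_i\in B_k$. Choose integers $n_k\ge 0$ with $\sum_k n_k=n$ and $|n_k-nN_k/N|<1$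 (that is, $n_k=nN_k/N$ up to rounding). In each cell let $y^{*(k)}_1,\dots,y^{*(k)}_{n_k}$ minimize, over $z_1,\dots,z_{n_k}\in\mathbb R$, $$\frac{2}{n_kN_k}\sum_{j=1}^{n_k}\ \sum_{i\le N:\ \mathbf x_i\in B_k}|z_j-y_i|-\frac1{n_k^2}\sum_{j=1}^{n_k}\sum_{l=1}^{n_k}|z_j-z_l| ,$$ and let $\mathbf x^{*(k)}_j$ be the covariate of an observation in $B_k$ whose response is nearest to $y^{*(k)}_j$ among all observations in $B_k$. Minimizers and nearest neighbours are chosen arbitrarily when they are not unique. Let $F_n$ be the empirical distribution of the $n$ points $(\mathbf x^{*(k)}_j,y^{*(k)}_j)$, $1\le k\le K$, $1\le j\le n_k$. **Theorem.** Assume that $f_{\mathbf X}$ is bounded away from $0$ and $\infty$ almost everywhere on $\mathcal X$, and that for almost every $y\in\mathcal Y$ the function $\mathbf x\mapsto f_{Y\mid\mathbf X}(y\mid\mathbf x)$ is uniformly continuous on $\mathcal X$. Assume that $K(n)\to\infty$ and that the partitions become fine: $\operatorname{diam}B_{\mathbf x}(n)\to0$ as $n\to\infty$ for almost every $\mathbf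 x\in\mathcal X$. Then, almost surely with respect to the observations, for every choice of the $n_k$, the minimizers and the nearest neighbours such that the number of points in each occupied cell tends to infinity, i.e. $\min\{n_k: N_k\ge 1\}\to\infty$ as $n\to\infty$, the distributions $F_n$ converge weakly to $F$; that is, with $(\mathbf X_n,Y_n)\sim F_n$, $(\mathbf X_n,Y_n)$ converges in distribution to $(\mathbf X,Y)$. -/

import Mathlib

open MeasureTheory ProbabilityTheory Filter Topology
open scoped NNReal ENNReal

/-- Step 1, the binning of the covariate space `𝒳 ⊆ ℝ^d`: the range of each of the `d` coordinates
of `𝒳` is divided into `κ` disjoint intervals. -/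
structure BinPartition {d : ℕ} (𝒳 : Set (EuclideanSpace ℝ (Fin d))) (κ : ℕ) where
  interval : Fin d → Fin κ → Set ℝ
  isInterval : ∀ q j, (interval q j).OrdConnected
  disjoint : ∀ q j j', j ≠ j' → Disjoint (interval q j) (interval q j')
  covers : ∀ x ∈ 𝒳, ∀ q, ∃ j, x q ∈ interval q j

namespace BinPartition

variable {d : ℕ} {𝒳 : Set (EuclideanSpace ℝ (Fin d))} {κ : ℕ}

/-- The `κ ^ d` cells `B_k` of the partition of `𝒳`, indexed by the multi-indices `k`. -/
def cell (B : BinPartition 𝒳 κ) (k : Fin d → Fin κ) : Set (EuclideanSpace ℝ (Fin d)) :=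
  {x | x ∈ 𝒳 ∧ ∀ q, x q ∈ B.interval q (k q)}

/-- `B_x`, the cell that contains `x`. -/
def cellOf (B : BinPartition 𝒳 κ) (x : EuclideanSpace ℝ (Fin d)) :
    Set (EuclideanSpace ℝ (Fin d)) :=
  {u | ∃ k, x ∈ B.cell k ∧ u ∈ B.cell k}

open Classical in
/-- The indices `i < N` of the observations `(x_i, y_i)` whose covariate lies in the cell `B_k`;
the cardinality of this set is `N_k`. -/
noncomputable def obs (B : BinPartition 𝒳 κ) (data : ℕ → EuclideanSpace ℝ (Fin d) × ℝ) (N : ℕ)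
    (k : Fin d → Fin κ) : Finset ℕ :=
  {i ∈ Finset.range N | (data i).1 ∈ B.cell k}

end BinPartition

/-- The Monte Carlo approximation of the energy distance between the distribution of the sample
`(y_i)_{i ∈ T}` and the empirical distribution of the points `z_1, …, z_m`, up to the term that does
not depend on `z`. -/
noncomputable def empiricalEnergy (T : Finset ℕ) (y : ℕ → ℝ) {m : ℕ} (z : Fin m → ℝ) : ℝ :=
  2 / ((m : ℝ) * (T.card : ℝ)) * ∑ j, ∑ i ∈ T, |z j - y i|
    - 1 / (m : ℝ) ^ 2 * ∑ j, ∑ l, |z j - z l|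

/-- `z_1, …, z_m` are support points of the sample `(y_i)_{i ∈ T}`: they minimize the empirical
energy among all `m`-tuples of reals. -/
def IsSupportPoints (T : Finset ℕ) (y : ℕ → ℝ) {m : ℕ} (z : Fin m → ℝ) : Prop :=
  ∀ z' : Fin m → ℝ, empiricalEnergy T y z ≤ empiricalEnergy T y z'

/-- A possible result of the selection of `n` conditional support points from the observations
`data i = (x_i, y_i)`, `i < N`, with the partition `B`. -/
structure ConditionalSupportPoints {d : ℕ} {𝒳 : Set (EuclideanSpace ℝ (Fin d))} {κ : ℕ}
    (B : BinPartition 𝒳 κ) (data : ℕ → EuclideanSpace ℝ (Fin d) × ℝ) (N n : ℕ+) where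
  /-- The number `n_k` of points allocated to the cell `B_k`. -/
  size : (Fin d → Fin κ) → ℕ
  /-- `n_k` is `n N_k / N`, rounded up or down to an integer. -/
  size_proportional : ∀ k, |(size k : ℝ) - (n : ℝ) * ((B.obs data N k).card : ℝ) / (N : ℝ)| < 1
  sum_size : ∑ k, size k = (n : ℕ)
  /-- The responses `y*_j`, which are support points of the responses observed in the cell. -/
  ystar : ∀ k, Fin (size k) → ℝ
  isSupportPoints : ∀ k, IsSupportPoints (B.obs data N k) (fun i => (data i).2) (ystar k)
  /-- The covariates `x*_j`, coupled to the `y*_j`: `x*_j` is the covariate of an observation in the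
  same cell whose response is nearest to `y*_j`. -/
  xstar : ∀ k, Fin (size k) → EuclideanSpace ℝ (Fin d)
  coupled : ∀ k j, ∃ i ∈ B.obs data N k, xstar k j = (data i).1 ∧
    ∀ i' ∈ B.obs data N k, |ystar k j - (data i).2| ≤ |ystar k j - (data i').2|

namespace ConditionalSupportPoints

variable {d : ℕ} {𝒳 : Set (EuclideanSpace ℝ (Fin d))} {κ : ℕ} {B : BinPartition 𝒳 κ}
  {data : ℕ → EuclideanSpace ℝ (Fin d) × ℝ} {N n : ℕ+}

/-- The empirical distribution `F_n` of the `n` selected points `(x*_j, y*_j)` of all cells. -/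
noncomputable def empiricalMeasure (S : ConditionalSupportPoints B data N n) :
    Measure (EuclideanSpace ℝ (Fin d) × ℝ) :=
  ((n : ℕ) : ℝ≥0∞)⁻¹ • ∑ k, ∑ j, Measure.dirac (S.xstar k j, S.ystar k j)

theorem isProbabilityMeasure_empiricalMeasure (S : ConditionalSupportPoints B data N n) :
    IsProbabilityMeasure S.empiricalMeasure := by
  constructor
  have h : (∑ k, (S.size k : ℝ≥0∞)) = ((n : ℕ) : ℝ≥0∞) := by
    rw [← S.sum_size, Nat.cast_sum]
  simp only [empiricalMeasure, Measure.smul_apply, Measure.finsetSum_apply, measure_univ,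
    Finset.sum_const, Finset.card_univ, Fintype.card_fin, nsmul_eq_mul, mul_one, smul_eq_mul, h]
  exact ENNReal.inv_mul_cancel (by simp) (by simp)

/-- `F_n` as a probability measure. -/
noncomputable def empiricalLaw (S : ConditionalSupportPoints B data N n) :
    ProbabilityMeasure (EuclideanSpace ℝ (Fin d) × ℝ) :=
  ⟨S.empiricalMeasure, S.isProbabilityMeasure_empiricalMeasure⟩

end ConditionalSupportPoints

/-!
The idea is to compare the selected points with the full sample cell by cell, and to use that the
empirical distribution of the full sample converges weakly to `F` almost surely
(`MeasureTheory.ae_forall_tendsto_average`, Varadarajan's theorem).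

*One cell.* On the line, the first-order conditions for the energy (moving a single point `z j`
slightly to the right or to the left does not decrease it) say that the empirical distribution
function of `m` support points is within `1 / (2 m)` of that of their sample, uniformly and
whatever the sample is: `IsSupportPoints.abs_sub_card_filter_le`. Integrating the derivative of a
Lipschitz function against this difference shows that its averages over the support points and over
the sample differ by `O(1 / m)`: `IsSupportPoints.abs_average_sub_average_le`. For a Lipschitz
function of `(x, y)` and a cell of diameter at most `δ`, freezing `x` costs another `O(δ)`, because
the coupled covariates stay in the cell.

*All cells.* If every occupied cell receives at least `M` points, then rounding changes the weight
of a cell by `1 / n ≤ (n_k / n) / M`, so that all rounding errors together are at most `1 / M`.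
The cells of diameter more than `δ` contribute at most a multiple of the proportion of observations
in them (`ConditionalSupportPoints.abs_integral_sub_average_le`). Almost every `x` lies in only
finitely many of these coarse regions, hence so does almost every observation, since `F` is
absolutely continuous; the law of large numbers for the decreasing unions of their tails then makes
this proportion vanish (`MeasureTheory.ae_tendsto_card_filter_div_zero`).
-/

/-! ### Support points of a sample on the line -/

theorem Finset.sum_ite_one_neg_one {ι : Type*} (s : Finset ι) (p : ι → Prop) [DecidablePred p] :
    ∑ i ∈ s, (if p i then (1 : ℝ) else -1) = 2 * ((s.filter p).card : ℝ) - s.card := by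
  have h (i : ι) : (if p i then (1 : ℝ) else -1) = 2 * (if p i then (1 : ℝ) else 0) - 1 := by
    split_ifs <;> norm_num
  simp only [h, Finset.sum_sub_distrib, ← Finset.mul_sum, Finset.sum_boole, Finset.sum_const,
    nsmul_eq_mul, mul_one]

theorem Finset.eventually_forall_le_or_add_le {ι : Type*} (s : Finset ι) (u : ι → ℝ) (p : ℝ) :
    ∀ᶠ ε in 𝓝[>] (0 : ℝ), ∀ i ∈ s, u i ≤ p ∨ p + ε ≤ u i := by
  rw [Filter.eventually_all_finset]
  intro i _
  rcases le_or_gt (u i) p with h | h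
  · exact Eventually.of_forall fun _ => Or.inl h
  · filter_upwards [Ioo_mem_nhdsGT (sub_pos.2 h)] with ε hε
    exact Or.inr (by linarith [hε.2])

/-- First-order condition at a support point `z j`, for a displacement to the right: the empirical
distribution function of the support points exceeds that of the sample by at most `1 / (2 m)` at
`z j`. -/
theorem IsSupportPoints.card_filter_le_div_le {T : Finset ℕ} {y : ℕ → ℝ} {m : ℕ} {z : Fin m → ℝ}
    (h : IsSupportPoints T y z) (hT : T.Nonempty) (j : Fin m) :
    (({l | z l ≤ z j} : Finset (Fin m)).card : ℝ) / m ≤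
      ((T.filter fun i => y i ≤ z j).card : ℝ) / T.card + 1 / (2 * m) := by
  have hm : (0 : ℝ) < m := by exact_mod_cast j.pos
  have hT' : (0 : ℝ) < T.card := by exact_mod_cast hT.card_pos
  -- `ε` is so small that moving `z j` by `ε` passes no other point
  obtain ⟨ε, ⟨hεT, hεz⟩, hε⟩ :=
    (((T.eventually_forall_le_or_add_le y (z j)).and
      (Finset.univ.eventually_forall_le_or_add_le z (z j))).and self_mem_nhdsWithin).exists
  replace hε : 0 < ε := hε
  set τ : ℕ → ℝ := fun i => if y i ≤ z j then 1 else -1 with hτ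
  set σ : Fin m → ℝ := fun l => if z l ≤ z j then 1 else -1 with hσ
  set z' := Function.update z j (z j + ε) with hz'
  have h₁ (a : Fin m) (i : ℕ) (hi : i ∈ T) :
      |z' a - y i| = |z a - y i| + (if a = j then ε * τ i else 0) := by
    by_cases ha : a = j
    · subst ha
      by_cases hy : y i ≤ z a
      · simp only [hz', Function.update_self, hτ, hy, if_true]
        rw [abs_of_nonneg (by linarith), abs_of_nonneg (by linarith)]; ring
      · have := (hεT i hi).resolve_left hy
        simp only [hz', Function.update_self, hτ, hy, if_true, if_false]
        rw [abs_of_nonpos (by linarith), abs_of_nonpos (by linarith)]; ring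
    · simp [hz', ha]
  have h₀ (l : Fin m) (hl : l ≠ j) : |z j + ε - z l| = |z j - z l| + ε * σ l := by
    by_cases hy : z l ≤ z j
    · simp only [hσ, hy, if_true]
      rw [abs_of_nonneg (by linarith), abs_of_nonneg (by linarith)]; ring
    · have := (hεz l (Finset.mem_univ l)).resolve_left hy
      simp only [hσ, hy, if_false]
      rw [abs_of_nonpos (by linarith), abs_of_nonpos (by linarith)]; ring
  have h₂ (a l : Fin m) : |z' a - z' l| = |z a - z l| + ((if a = j then ε * σ l else 0)
      + (if l = j then ε * σ a else 0) - (if a = j then if l = j then 2 * ε else 0 else 0)) := by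
    by_cases ha : a = j <;> by_cases hl : l = j
    · subst ha; subst hl; simp [hσ]; ring
    · subst ha; simp [hz', hl, h₀ l hl]
    · subst hl; simp only [hz', ne_eq, ha, not_false_eq_true, Function.update_of_ne,
        Function.update_self, if_false, if_true]
      rw [abs_sub_comm, h₀ a ha, abs_sub_comm]; ring
    · simp [hz', ha, hl]
  have e₁ : ∑ a, ∑ i ∈ T, |z' a - y i| = ∑ a, ∑ i ∈ T, |z a - y i| + ε * ∑ i ∈ T, τ i := by
    rw [Finset.sum_congr rfl fun a _ => Finset.sum_congr rfl fun i hi => h₁ a i hi]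
    simp only [Finset.sum_add_distrib]
    rw [Finset.sum_comm (f := fun a i => if a = j then ε * τ i else 0)]
    simp [Finset.mul_sum]
  have e₂ : ∑ a, ∑ l, |z' a - z' l| = ∑ a, ∑ l, |z a - z l| + ε * (2 * ∑ l, σ l - 2) := by
    simp only [h₂, Finset.sum_add_distrib, Finset.sum_sub_distrib]
    rw [Finset.sum_comm (f := fun a l => if a = j then ε * σ l else 0)]
    simp only [Finset.sum_ite_eq', Finset.mem_univ, if_true, ← Finset.mul_sum]
    simp
    ring
  have key := h z'
  simp only [empiricalEnergy, e₁, e₂] at key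
  simp only [hτ, hσ, Finset.sum_ite_one_neg_one, Finset.card_univ, Fintype.card_fin] at key
  set f := (({l | z l ≤ z j} : Finset (Fin m)).card : ℝ)
  set g := ((T.filter fun i => y i ≤ z j).card : ℝ)
  have k2 : 0 ≤ ε * (2 / (m * T.card) * (2 * g - T.card)
      - 1 / (m : ℝ) ^ 2 * (2 * (2 * f - m) - 2)) := by
    linarith
  have k3 := nonneg_of_mul_nonneg_right k2 hε
  have k4 : 2 / (m * T.card) * (2 * g - T.card) - 1 / (m : ℝ) ^ 2 * (2 * (2 * f - m) - 2)
      = 4 / m * (g / T.card + 1 / (2 * m) - f / m) := by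
    field_simp; ring
  rw [k4] at k3
  linarith [nonneg_of_mul_nonneg_right k3 (by positivity)]

theorem IsSupportPoints.neg {T : Finset ℕ} {y : ℕ → ℝ} {m : ℕ} {z : Fin m → ℝ}
    (h : IsSupportPoints T y z) : IsSupportPoints T (-y) (-z) := by
  have e (w : Fin m → ℝ) : empiricalEnergy T (-y) w = empiricalEnergy T y (-w) := by
    have h₁ (a : ℝ) (i : ℕ) : |a - -y i| = |-a - y i| := by rw [← abs_neg]; ring_nf
    have h₂ (a b : ℝ) : |-a - -b| = |a - b| := by rw [← abs_neg]; ring_nf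
    simp only [empiricalEnergy, Pi.neg_apply, h₁, h₂]
  intro w
  rw [e, e, neg_neg]
  exact h _

/-- The first-order condition for displacements to the left, by reflection. -/
theorem IsSupportPoints.card_filter_ge_div_le {T : Finset ℕ} {y : ℕ → ℝ} {m : ℕ} {z : Fin m → ℝ}
    (h : IsSupportPoints T y z) (hT : T.Nonempty) (j : Fin m) :
    (({l | z j ≤ z l} : Finset (Fin m)).card : ℝ) / m ≤
      ((T.filter fun i => z j ≤ y i).card : ℝ) / T.card + 1 / (2 * m) := by
  simpa using h.neg.card_filter_le_div_le hT j

theorem IsSupportPoints.exists_le {T : Finset ℕ} {y : ℕ → ℝ} {m : ℕ} {z : Fin m → ℝ}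
    (h : IsSupportPoints T y z) (hT : T.Nonempty) (j : Fin m) : ∃ i ∈ T, y i ≤ z j := by
  by_contra! hc
  have hm : (0 : ℝ) < m := by exact_mod_cast j.pos
  have h1 := h.card_filter_le_div_le hT j
  rw [Finset.filter_false_of_mem (s := T) (fun i hi => not_le.2 (hc i hi))] at h1
  have h2 : (1 : ℝ) ≤ (({l | z l ≤ z j} : Finset (Fin m)).card : ℝ) := by
    exact_mod_cast Finset.card_pos.2 ⟨j, by simp⟩
  -- a point to the left of the whole sample would violate the first-order condition: `1 ≤ 1 / 2`
  have h3 := h2.trans ((div_le_iff₀ hm).1 h1)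
  have h4 : (((∅ : Finset ℕ).card : ℝ) / T.card + 1 / (2 * m)) * m = 1 / 2 := by
    simp; field_simp
  linarith

/-- The empirical distribution functions of `m` support points and of their sample differ by at
most `1 / (2 m)`, whatever the size of the sample and its ties. -/
theorem IsSupportPoints.abs_sub_card_filter_le {T : Finset ℕ} {y : ℕ → ℝ} {m : ℕ} {z : Fin m → ℝ}
    (h : IsSupportPoints T y z) (hT : T.Nonempty) (hm : 0 < m) (t : ℝ) :
    |(({l | z l ≤ t} : Finset (Fin m)).card : ℝ) / m
      - ((T.filter fun i => y i ≤ t).card : ℝ) / T.card| ≤ 1 / (2 * m) := by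
  have hm' : (0 : ℝ) < m := by exact_mod_cast hm
  have hT' : (0 : ℝ) < T.card := by exact_mod_cast hT.card_pos
  have split_z : (({l | z l ≤ t} : Finset (Fin m)).card : ℝ) / m
      = 1 - (({l | t < z l} : Finset (Fin m)).card : ℝ) / m := by
    have := Finset.card_filter_add_card_filter_not (s := (Finset.univ : Finset (Fin m)))
      (fun l => z l ≤ t)
    simp only [not_le, Finset.card_univ, Fintype.card_fin] at this
    rw [eq_sub_iff_add_eq, ← add_div, div_eq_one_iff_eq hm'.ne']
    exact_mod_cast this
  have split_y : ((T.filter fun i => y i ≤ t).card : ℝ) / T.card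
      = 1 - ((T.filter fun i => t < y i).card : ℝ) / T.card := by
    have := Finset.card_filter_add_card_filter_not (s := T) (fun i => y i ≤ t)
    simp only [not_le] at this
    rw [eq_sub_iff_add_eq, ← add_div, div_eq_one_iff_eq hT'.ne']
    exact_mod_cast this
  rw [abs_le]
  constructor
  · -- compare at the smallest support point to the right of `t`
    rw [split_z, split_y]
    rcases ({l | t < z l} : Finset (Fin m)).eq_empty_or_nonempty with he | hne
    · rw [he, Finset.card_empty, Nat.cast_zero, zero_div]
      have h1 : 0 ≤ ((T.filter fun i => t < y i).card : ℝ) / T.card := by positivity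
      have h2 : 0 ≤ 1 / (2 * (m : ℝ)) := by positivity
      linarith
    · obtain ⟨j, hj, hmin⟩ := Finset.exists_min_image _ z hne
      simp only [Finset.mem_filter, Finset.mem_univ, true_and] at hj hmin
      have h1 := h.card_filter_ge_div_le hT j
      have h2 : (Finset.univ.filter fun l => z j ≤ z l) = Finset.univ.filter fun l => t < z l := by
        ext l; simp only [Finset.mem_filter, Finset.mem_univ, true_and]
        exact ⟨fun hl => hj.trans_le hl, fun hl => hmin l hl⟩
      rw [h2] at h1
      have h3 : ((T.filter fun i => z j ≤ y i).card : ℝ) / T.card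
          ≤ ((T.filter fun i => t < y i).card : ℝ) / T.card := by
        gcongr
      linarith
  · -- compare at the largest support point not exceeding `t`
    rcases ({l | z l ≤ t} : Finset (Fin m)).eq_empty_or_nonempty with he | hne
    · rw [he, Finset.card_empty, Nat.cast_zero, zero_div]
      have h1 : 0 ≤ ((T.filter fun i => y i ≤ t).card : ℝ) / T.card := by positivity
      have h2 : 0 ≤ 1 / (2 * (m : ℝ)) := by positivity
      linarith
    · obtain ⟨j, hj, hmax⟩ := Finset.exists_max_image _ z hne
      simp only [Finset.mem_filter, Finset.mem_univ, true_and] at hj hmax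
      have h1 := h.card_filter_le_div_le hT j
      have h2 : (Finset.univ.filter fun l => z l ≤ z j) = Finset.univ.filter fun l => z l ≤ t := by
        ext l; simp only [Finset.mem_filter, Finset.mem_univ, true_and]
        exact ⟨fun hl => hl.trans hj, fun hl => hmax l hl⟩
      rw [h2] at h1
      have h3 : ((T.filter fun i => y i ≤ z j).card : ℝ) / T.card
          ≤ ((T.filter fun i => y i ≤ t).card : ℝ) / T.card := by
        gcongr
      linarith

/-- Support points lie in the convex hull of their sample. -/
theorem IsSupportPoints.mem_Icc {T : Finset ℕ} {y : ℕ → ℝ} {m : ℕ} {z : Fin m → ℝ}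
    (h : IsSupportPoints T y z) (hT : T.Nonempty) {a b : ℝ} (hy : ∀ i ∈ T, y i ∈ Set.Icc a b)
    (j : Fin m) : z j ∈ Set.Icc a b := by
  obtain ⟨i, hi, h1⟩ := h.exists_le hT j
  obtain ⟨i', hi', h2⟩ := h.neg.exists_le hT j
  simp only [Pi.neg_apply, neg_le_neg_iff] at h2
  exact ⟨(hy i hi).1.trans h1, h2.trans (hy i' hi').2⟩

theorem LipschitzWith.eq_sub_integral_deriv {ψ : ℝ → ℝ} {L : ℝ≥0} (hψ : LipschitzWith L ψ)
    {a b u : ℝ} (hu : u ∈ Set.Icc a b) :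
    ψ u = ψ b - ∫ t in a..b, (if u ≤ t then deriv ψ t else 0) := by
  have hac (c : ℝ) : AbsolutelyContinuousOnInterval ψ c b :=
    (hψ.lipschitzOnWith (s := Set.uIcc c b)).absolutelyContinuousOnInterval
  have h1 : ∫ t in a..b, (if u ≤ t then deriv ψ t else 0) = ∫ t in u..b, deriv ψ t := by
    rw [intervalIntegral.integral_of_le (hu.1.trans hu.2), intervalIntegral.integral_of_le hu.2,
      ← integral_Icc_eq_integral_Ioc, ← integral_Icc_eq_integral_Ioc,
      ← integral_indicator measurableSet_Icc, ← integral_indicator measurableSet_Icc]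
    congr 1
    ext t
    simp only [Set.indicator, Set.mem_Icc]
    grind [hu.1]
  rw [h1, (hac u).integral_deriv_eq_sub]
  ring

/-- The average of a Lipschitz function over finitely many points of `[a, b]`, in terms of their
empirical distribution function. -/
theorem Finset.average_eq_sub_integral {ι : Type*} {s : Finset ι} (hs : s.Nonempty) {u : ι → ℝ}
    {a b : ℝ} (hu : ∀ i ∈ s, u i ∈ Set.Icc a b) {ψ : ℝ → ℝ} {L : ℝ≥0} (hψ : LipschitzWith L ψ) :
    (∑ i ∈ s, ψ (u i)) / s.card
      = ψ b - ∫ t in a..b, ((s.filter fun i => u i ≤ t).card : ℝ) / s.card * deriv ψ t := by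
  have hs' : (s.card : ℝ) ≠ 0 := by exact_mod_cast hs.card_pos.ne'
  have hi : ∀ i ∈ s, IntervalIntegrable (fun t => if u i ≤ t then deriv ψ t else 0) volume a b := by
    intro i _
    have h0 : IntervalIntegrable (deriv ψ) volume a b :=
      (hψ.lipschitzOnWith (s := Set.uIcc a b)).absolutelyContinuousOnInterval.intervalIntegrable_deriv
    refine h0.mono_fun ?_ (Eventually.of_forall fun t => ?_)
    · exact (Measurable.ite measurableSet_Ici (measurable_deriv ψ)
        measurable_const).aestronglyMeasurable
    · dsimp only; split_ifs <;> simp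
  rw [Finset.sum_congr rfl fun i hi => hψ.eq_sub_integral_deriv (hu i hi), Finset.sum_sub_distrib,
    ← intervalIntegral.integral_finsetSum hi, sub_div, Finset.sum_const, nsmul_eq_mul,
    mul_div_cancel_left₀ _ hs', ← intervalIntegral.integral_div]
  congr 2
  ext t
  rw [← Finset.sum_filter, Finset.sum_const, nsmul_eq_mul]
  ring

/-- Support points integrate an `L`-Lipschitz function with an error of order `L / m`: the
difference of the averages is `∫ (G - F) ψ'`, where `F` and `G` are the empirical distribution
functions of the support points and of the sample. -/
theorem IsSupportPoints.abs_average_sub_average_le {T : Finset ℕ} {y : ℕ → ℝ} {m : ℕ}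
    {z : Fin m → ℝ} (h : IsSupportPoints T y z) (hT : T.Nonempty) (hm : 0 < m) {a b : ℝ}
    (hy : ∀ i ∈ T, y i ∈ Set.Icc a b) {ψ : ℝ → ℝ} {L : ℝ≥0} (hψ : LipschitzWith L ψ) :
    |(∑ j, ψ (z j)) / m - (∑ i ∈ T, ψ (y i)) / T.card| ≤ L * (b - a) / (2 * m) := by
  have hab : a ≤ b := by
    obtain ⟨i, hi⟩ := hT
    exact (hy i hi).1.trans (hy i hi).2
  have : Nonempty (Fin m) := ⟨⟨0, hm⟩⟩
  have hm' : (0 : ℝ) < m := by exact_mod_cast hm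
  have h1 := Finset.average_eq_sub_integral (Finset.univ_nonempty (α := Fin m))
    (fun j _ => h.mem_Icc hT hy j) hψ
  rw [Finset.card_univ, Fintype.card_fin] at h1
  have h0 : IntervalIntegrable (deriv ψ) volume a b :=
    (hψ.lipschitzOnWith (s := Set.uIcc a b)).absolutelyContinuousOnInterval.intervalIntegrable_deriv
  have hint {ι : Type} (s : Finset ι) (u : ι → ℝ) : IntervalIntegrable
      (fun t => ((s.filter fun i => u i ≤ t).card : ℝ) / s.card * deriv ψ t) volume a b := by
    refine h0.mono_fun ?_ (Eventually.of_forall fun t => ?_)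
    · have : Measurable fun t => ((s.filter fun i => u i ≤ t).card : ℝ) := by
        simp only [Finset.card_filter, Nat.cast_sum]
        refine Finset.measurable_sum _ fun i _ => ?_
        simp only [Nat.cast_ite]
        exact Measurable.ite measurableSet_Ici measurable_const measurable_const
      exact ((this.div_const _).mul (measurable_deriv ψ)).aestronglyMeasurable
    · dsimp only
      rw [norm_mul]
      refine mul_le_of_le_one_left (norm_nonneg _) ?_
      rw [Real.norm_of_nonneg (by positivity)]
      exact div_le_one_of_le₀ (by exact_mod_cast Finset.card_filter_le _ _) (by positivity)
  have i1 := hint (Finset.univ : Finset (Fin m)) z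
  rw [Finset.card_univ, Fintype.card_fin] at i1
  rw [h1, Finset.average_eq_sub_integral hT hy hψ, sub_sub_sub_cancel_left,
    ← intervalIntegral.integral_sub (hint T y) i1]
  rw [← Real.norm_eq_abs]
  refine (intervalIntegral.norm_integral_le_of_norm_le_const (C := 1 / (2 * m) * L)
    fun t _ => ?_).trans_eq ?_
  · rw [← sub_mul, norm_mul]
    refine mul_le_mul ?_ (norm_deriv_le_of_lipschitz hψ) (norm_nonneg _) (by positivity)
    rw [Real.norm_eq_abs, abs_sub_comm]
    exact h.abs_sub_card_filter_le hT hm t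
  · rw [abs_of_nonneg (sub_nonneg.2 hab)]; ring

/-! ### Laws of large numbers for empirical measures -/

open Classical in
theorem MeasureTheory.ae_tendsto_card_filter_div {E Ω : Type*} [MeasurableSpace E]
    [MeasurableSpace Ω] {P : Measure Ω} [IsProbabilityMeasure P] {μ : Measure E} {X : ℕ → Ω → E}
    (hlaw : ∀ i, HasLaw (X i) μ P) (hindep : iIndepFun X P) {A : Set E} (hA : MeasurableSet A) :
    ∀ᵐ ω ∂P, Tendsto (fun n : ℕ => (((Finset.range n).filter fun i => X i ω ∈ A).card : ℝ) / n)
      atTop (𝓝 (μ.real A)) := by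
  have hf : Measurable (A.indicator (1 : E → ℝ)) := measurable_one.indicator hA
  have h := strong_law_ae_real (μ := P) (fun i ω => A.indicator (1 : E → ℝ) (X i ω)) ?_ ?_ ?_
  · have h0 : ∫ ω, A.indicator (1 : E → ℝ) (X 0 ω) ∂P = μ.real A := by
      rw [← integral_map (hlaw 0).aemeasurable hf.aestronglyMeasurable, (hlaw 0).map_eq,
        integral_indicator_one hA]
    simp only [h0] at h
    filter_upwards [h] with ω hω
    refine hω.congr fun n => ?_
    simp [Set.indicator_apply, Finset.sum_boole]
  · refine Integrable.of_bound (C := 1)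
      (hf.comp_aemeasurable (hlaw 0).aemeasurable).aestronglyMeasurable
      (Eventually.of_forall fun ω => ?_)
    simp only [Set.indicator_apply, Pi.one_apply]
    split_ifs <;> simp
  · intro i j hij
    exact (hindep.indepFun hij).comp hf hf
  · intro i
    refine IdentDistrib.comp (u := A.indicator (1 : E → ℝ))
      ⟨(hlaw i).aemeasurable, (hlaw 0).aemeasurable, ?_⟩ hf
    rw [(hlaw i).map_eq, (hlaw 0).map_eq]

/-- Varadarajan's theorem: almost surely, the averages of all bounded continuous functions over a
sample from `μ` converge simultaneously. It is enough to have the law of large numbers for the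
finite unions of sets of a countable basis, by the portmanteau theorem. -/
theorem MeasureTheory.ae_forall_tendsto_average {E Ω : Type*} [PseudoMetricSpace E]
    [SecondCountableTopology E] [MeasurableSpace E] [OpensMeasurableSpace E]
    [MeasurableSpace Ω] {P : Measure Ω} [IsProbabilityMeasure P] (μ : ProbabilityMeasure E)
    {X : ℕ → Ω → E} (hlaw : ∀ i, HasLaw (X i) (μ : Measure E) P) (hindep : iIndepFun X P) :
    ∀ᵐ ω ∂P, ∀ f : BoundedContinuousFunction E ℝ,
      Tendsto (fun n : ℕ => (∑ i ∈ Finset.range n, f (X i ω)) / n) atTop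
        (𝓝 (∫ p, f p ∂(μ : Measure E))) := by
  classical
  have : Countable (TopologicalSpace.countableBasis E) :=
    (TopologicalSpace.countable_countableBasis E).to_subtype
  let U : Finset (TopologicalSpace.countableBasis E) → Set E := fun s => ⋃ b ∈ s, (b : Set E)
  have hU (s) : MeasurableSet (U s) := (isOpen_biUnion fun b _ =>
    TopologicalSpace.isOpen_of_mem_countableBasis b.2).measurableSet
  filter_upwards [ae_all_iff.2 fun s => ae_tendsto_card_filter_div hlaw hindep (hU s)] with ω hω f
  let ν : ℕ → Measure E := fun n =>
    ((n + 1 : ℕ) : ℝ≥0∞)⁻¹ • ∑ i ∈ Finset.range (n + 1), Measure.dirac (X i ω)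
  have hν (n : ℕ) : IsProbabilityMeasure (ν n) := by
    constructor
    simp only [ν, Measure.smul_apply, Measure.finsetSum_apply, measure_univ,
      Finset.sum_const, Finset.card_range, nsmul_eq_mul, mul_one, smul_eq_mul]
    exact ENNReal.inv_mul_cancel (by simp) (by simp)
  have hνA (n : ℕ) (A : Set E) (hA : MeasurableSet A) : ν n A =
      ENNReal.ofReal
        ((((Finset.range (n + 1)).filter fun i => X i ω ∈ A).card : ℝ) / (n + 1 : ℕ)) := by
    rw [ENNReal.ofReal_div_of_pos (by positivity), ENNReal.ofReal_natCast, ENNReal.ofReal_natCast]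
    simp only [ν, Measure.smul_apply, Measure.finsetSum_apply, smul_eq_mul]
    rw [ENNReal.div_eq_inv_mul]
    congr 1
    simp [Measure.dirac_apply' _ hA, Set.indicator_apply, Finset.sum_boole]
  have hconv : Tendsto (β := ProbabilityMeasure E) (fun n => ⟨ν n, hν n⟩) atTop (𝓝 μ) := by
    refine tendsto_of_forall_isOpen_le_liminf' fun G hG => ?_
    obtain ⟨S, hSb, rfl⟩ :=
      (TopologicalSpace.isBasis_countableBasis E).open_eq_sUnion hG
    -- `G` is the directed union of the finite unions of basic sets that it contains
    let V : Finset S → Set E := fun s => ⋃ b ∈ s, (b : Set E)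
    have hSc : Countable S :=
      ((TopologicalSpace.countable_countableBasis E).mono hSb).to_subtype
    have hGV : ⋃₀ S = ⋃ s, V s := by
      ext x
      simp only [Set.mem_sUnion, Set.mem_iUnion, V]
      constructor
      · rintro ⟨b, hb, hx⟩
        exact ⟨{⟨b, hb⟩}, ⟨b, hb⟩, by simp, hx⟩
      · rintro ⟨s, b, _, hx⟩
        exact ⟨b, b.2, hx⟩
    have hmono : Monotone V := fun s t hst => Set.biUnion_mono hst fun _ _ => subset_rfl
    rw [hGV, hmono.directed_le.measure_iUnion]
    refine iSup_le fun s => ?_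
    have hs : V s = U (s.image (Set.inclusion hSb)) := by
      simp only [V, U, Finset.set_biUnion_finset_image]
    have hlim : Tendsto (fun n => ν n (V s)) atTop (𝓝 ((μ : Measure E) (V s))) := by
      rw [hs, ← ofReal_measureReal (measure_ne_top _ _)]
      refine (ENNReal.tendsto_ofReal ((hω _).comp (tendsto_add_atTop_nat 1))).congr fun n => ?_
      exact (hνA n _ (hU _)).symm
    rw [← hlim.liminf_eq]
    exact liminf_le_liminf (Eventually.of_forall fun n =>
      measure_mono (Set.subset_iUnion V s))
  have h := (ProbabilityMeasure.tendsto_iff_forall_integral_tendsto.1 hconv) f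
  rw [← tendsto_add_atTop_iff_nat 1]
  refine h.congr fun n => ?_
  have hd (i : ℕ) : ∫ p, f p ∂(Measure.dirac (X i ω)) = f (X i ω) :=
    integral_dirac' _ _ f.continuous.stronglyMeasurable
  have hdi : ∀ i ∈ Finset.range (n + 1), Integrable f (Measure.dirac (X i ω)) :=
    fun i _ => f.integrable _
  change ∫ p, f p ∂(ν n) = _
  simp only [ν]
  rw [integral_smul_measure, integral_finsetSum_measure hdi]
  simp only [hd, smul_eq_mul, ENNReal.toReal_inv, ENNReal.toReal_natCast]
  rw [div_eq_inv_mul]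

open Classical in
/-- If almost every point lies in only finitely many of the sets `A n`, then almost surely the
proportion of the first `N n` observations that fall into `A n` tends to zero, however slowly `N n`
grows: `A n` lies in the fixed set `⋃ l ≥ m, A l`, which has small measure, for `n ≥ m`. -/
theorem MeasureTheory.ae_tendsto_card_filter_div_zero {E Ω : Type*} [MeasurableSpace E]
    [MeasurableSpace Ω] {P : Measure Ω} [IsProbabilityMeasure P] {μ : Measure E}
    [IsProbabilityMeasure μ] {X : ℕ → Ω → E} (hlaw : ∀ i, HasLaw (X i) μ P)
    (hindep : iIndepFun X P) {A : ℕ+ → Set E} (hA : ∀ n, MeasurableSet (A n))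
    (hA0 : ∀ᵐ x ∂μ, ∀ᶠ n in atTop, x ∉ A n) {N : ℕ+ → ℕ} (hN : Tendsto N atTop atTop) :
    ∀ᵐ ω ∂P, Tendsto (fun n => (((Finset.range (N n)).filter fun i => X i ω ∈ A n).card : ℝ) / N n)
      atTop (𝓝 0) := by
  let U : ℕ+ → Set E := fun m => ⋃ l ∈ Set.Ici m, A l
  have hU (m) : MeasurableSet (U m) := MeasurableSet.biUnion (Set.to_countable _) fun l _ => hA l
  have hanti : Antitone U := fun m m' h => Set.biUnion_subset_biUnion_left (Set.Ici_subset_Ici.2 h)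
  have hlim : Tendsto (fun m => μ.real (U m)) atTop (𝓝 0) := by
    have h1 := tendsto_measure_iInter_atTop (μ := μ) (fun m => (hU m).nullMeasurableSet) hanti
      ⟨1, measure_ne_top _ _⟩
    have h2 : μ (⋂ m, U m) = 0 := by
      refine measure_mono_null (fun x hx => ?_) hA0
      simp only [U, Set.mem_iInter, Set.mem_iUnion, Set.mem_Ici] at hx
      simp only [Set.mem_compl_iff, Set.mem_ofPred_eq, not_eventually, not_not, frequently_atTop]
      intro m
      obtain ⟨l, hl, h⟩ := hx m
      exact ⟨l, hl, h⟩
    rw [h2] at h1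
    simpa [Measure.real] using! (ENNReal.tendsto_toReal ENNReal.zero_ne_top).comp h1
  filter_upwards [ae_all_iff.2 fun m => ae_tendsto_card_filter_div hlaw hindep (hU m)] with ω hω
  rw [Metric.tendsto_atTop']
  intro ε hε
  obtain ⟨m, hm⟩ := (hlim.eventually (gt_mem_nhds hε)).exists
  obtain ⟨n₀, hn₀⟩ := eventually_atTop.1 (((hω m).comp hN).eventually (gt_mem_nhds hm))
  refine ⟨max m n₀, fun n hn => ?_⟩
  rw [Real.dist_0_eq_abs, abs_of_nonneg (by positivity)]
  refine lt_of_le_of_lt ?_ (hn₀ n ((le_max_right _ _).trans hn.le))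
  simp only [Function.comp_apply]
  gcongr
  intro x hi
  exact Set.mem_biUnion (Set.mem_Ici.2 ((le_max_left _ _).trans hn.le)) hi

/-! ### The cells of a partition -/

namespace BinPartition

variable {d : ℕ} {𝒳 : Set (EuclideanSpace ℝ (Fin d))} {κ : ℕ}

theorem measurableSet_cell (B : BinPartition 𝒳 κ) (h𝒳 : MeasurableSet 𝒳) (k : Fin d → Fin κ) :
    MeasurableSet (B.cell k) := by
  have h : B.cell k = 𝒳 ∩ ⋂ q, (fun x : EuclideanSpace ℝ (Fin d) => x q) ⁻¹' B.interval q (k q) := by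
    ext x; simp [cell]
  rw [h]
  refine h𝒳.inter (MeasurableSet.iInter fun q => ?_)
  exact measurableSet_preimage (by fun_prop) (B.isInterval q (k q)).measurableSet

theorem eq_of_mem_cell (B : BinPartition 𝒳 κ) {x : EuclideanSpace ℝ (Fin d)}
    {k k' : Fin d → Fin κ} (h : x ∈ B.cell k) (h' : x ∈ B.cell k') : k = k' := by
  ext1 q
  by_contra hne
  exact Set.disjoint_left.1 (B.disjoint q _ _ hne) (h.2 q) (h'.2 q)

theorem exists_mem_cell (B : BinPartition 𝒳 κ) {x : EuclideanSpace ℝ (Fin d)} (hx : x ∈ 𝒳) :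
    ∃ k, x ∈ B.cell k := by
  choose k hk using B.covers x hx
  exact ⟨k, hx, hk⟩

theorem cellOf_eq_cell (B : BinPartition 𝒳 κ) {x : EuclideanSpace ℝ (Fin d)} {k : Fin d → Fin κ}
    (hx : x ∈ B.cell k) : B.cellOf x = B.cell k := by
  ext u
  constructor
  · rintro ⟨k', hk', hu⟩
    rwa [B.eq_of_mem_cell hx hk']
  · exact fun hu => ⟨k, hx, hu⟩

/-- The union of the cells whose diameter exceeds `δ`. -/
def coarse (B : BinPartition 𝒳 κ) (δ : ℝ≥0∞) : Set (EuclideanSpace ℝ (Fin d)) :=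
  ⋃ k, ⋃ _ : δ < Metric.ediam (B.cell k), B.cell k

theorem measurableSet_coarse (B : BinPartition 𝒳 κ) (h𝒳 : MeasurableSet 𝒳) (δ : ℝ≥0∞) :
    MeasurableSet (B.coarse δ) :=
  MeasurableSet.iUnion fun k => MeasurableSet.iUnion fun _ => B.measurableSet_cell h𝒳 k

theorem lt_ediam_of_mem_coarse (B : BinPartition 𝒳 κ) {δ : ℝ≥0∞} {x : EuclideanSpace ℝ (Fin d)}
    (hx : x ∈ B.coarse δ) : δ < Metric.ediam (B.cellOf x) := by
  simp only [coarse, Set.mem_iUnion] at hx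
  obtain ⟨k, hk, hx⟩ := hx
  rwa [B.cellOf_eq_cell hx]

theorem mem_coarse (B : BinPartition 𝒳 κ) {δ : ℝ≥0∞} {x : EuclideanSpace ℝ (Fin d)}
    {k : Fin d → Fin κ} (hx : x ∈ B.cell k) (hk : δ < Metric.ediam (B.cell k)) :
    x ∈ B.coarse δ :=
  Set.mem_iUnion.2 ⟨k, Set.mem_iUnion.2 ⟨hk, hx⟩⟩

theorem mem_obs {B : BinPartition 𝒳 κ} {data : ℕ → EuclideanSpace ℝ (Fin d) × ℝ} {N : ℕ}
    {k : Fin d → Fin κ} {i : ℕ} : i ∈ B.obs data N k ↔ i < N ∧ (data i).1 ∈ B.cell k := by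
  simp [obs]

theorem sum_sum_obs (B : BinPartition 𝒳 κ) {data : ℕ → EuclideanSpace ℝ (Fin d) × ℝ} {N : ℕ}
    (hdata : ∀ i, (data i).1 ∈ 𝒳) (g : ℕ → ℝ) :
    ∑ k, ∑ i ∈ B.obs data N k, g i = ∑ i ∈ Finset.range N, g i := by
  choose c hc using fun i => B.exists_mem_cell (hdata i)
  rw [← Finset.sum_fiberwise (Finset.range N) c g]
  refine Finset.sum_congr rfl fun k _ => Finset.sum_congr ?_ fun _ _ => rfl
  ext i
  simp only [mem_obs, Finset.mem_filter, Finset.mem_range]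
  refine and_congr_right fun _ => ⟨fun h => B.eq_of_mem_cell (hc i) h, fun h => h ▸ hc i⟩

end BinPartition

/-! ### Comparison of the selected points with the full sample -/

theorem Finset.abs_average_sub_average_le {ι : Type*} (s : Finset ι) {f g : ι → ℝ} {c : ℝ}
    (hc : 0 ≤ c) (h : ∀ i ∈ s, |f i - g i| ≤ c) :
    |(∑ i ∈ s, f i) / s.card - (∑ i ∈ s, g i) / s.card| ≤ c := by
  rw [← sub_div, ← Finset.sum_sub_distrib, abs_div, Nat.abs_cast]
  refine div_le_of_le_mul₀ (by positivity) hc ?_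
  refine (Finset.abs_sum_le_sum_abs _ _).trans ((Finset.sum_le_card_nsmul _ _ _ h).trans_eq ?_)
  rw [nsmul_eq_mul, mul_comm]

theorem Finset.abs_average_le {ι : Type*} (s : Finset ι) {f : ι → ℝ} {c : ℝ}
    (hc : 0 ≤ c) (h : ∀ i ∈ s, |f i| ≤ c) : |(∑ i ∈ s, f i) / s.card| ≤ c := by
  simpa using s.abs_average_sub_average_le (g := 0) hc (by simpa using h)

namespace ConditionalSupportPoints

variable {d : ℕ} {𝒳 : Set (EuclideanSpace ℝ (Fin d))} {κ : ℕ} {B : BinPartition 𝒳 κ}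
  {data : ℕ → EuclideanSpace ℝ (Fin d) × ℝ} {N n : ℕ+}

theorem size_eq_zero (S : ConditionalSupportPoints B data N n) {k : Fin d → Fin κ}
    (hk : B.obs data N k = ∅) : S.size k = 0 := by
  have h := S.size_proportional k
  rw [hk, Finset.card_empty, Nat.cast_zero, mul_zero, zero_div, sub_zero, Nat.abs_cast] at h
  exact_mod_cast Nat.lt_one_iff.1 (by exact_mod_cast h)

theorem integral_empiricalMeasure (S : ConditionalSupportPoints B data N n)
    (f : BoundedContinuousFunction (EuclideanSpace ℝ (Fin d) × ℝ) ℝ) :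
    ∫ p, f p ∂S.empiricalMeasure = (∑ k, ∑ j, f (S.xstar k j, S.ystar k j)) / (n : ℝ) := by
  rw [empiricalMeasure, integral_smul_measure, integral_finsetSum_measure]
  · have h (k) : ∫ p, f p ∂(∑ j, Measure.dirac (S.xstar k j, S.ystar k j))
        = ∑ j, f (S.xstar k j, S.ystar k j) := by
      rw [integral_finsetSum_measure fun j _ => f.integrable _]
      exact Finset.sum_congr rfl fun j _ =>
        integral_dirac' _ _ f.continuous.stronglyMeasurable
    simp only [h, smul_eq_mul, ENNReal.toReal_inv, ENNReal.toReal_natCast]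
    rw [div_eq_inv_mul]
  · exact fun k _ => f.integrable _

/-- In a cell of diameter at most `δ`, the selected points and the observations have nearly the
same averages: replacing every covariate by that of a fixed observation of the cell reduces this to
the one-dimensional estimate for support points. -/
theorem abs_average_sub_average_le (S : ConditionalSupportPoints B data N n) {k : Fin d → Fin κ}
    (hk : (B.obs data N k).Nonempty) (hm : 0 < S.size k) {δ R : ℝ≥0}
    (hδ : Metric.ediam (B.cell k) ≤ δ) (hR : ∀ i, (data i).2 ∈ Set.Icc (-R : ℝ) R)
    {f : EuclideanSpace ℝ (Fin d) × ℝ → ℝ} {L : ℝ≥0} (hf : LipschitzWith L f) :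
    |(∑ j, f (S.xstar k j, S.ystar k j)) / S.size k
      - (∑ i ∈ B.obs data N k, f (data i)) / (B.obs data N k).card|
      ≤ 2 * (L * δ) + L * R / S.size k := by
  obtain ⟨i₀, hi₀⟩ := hk
  have hcell {x x' : EuclideanSpace ℝ (Fin d)} (hx : x ∈ B.cell k) (hx' : x' ∈ B.cell k) (y : ℝ) :
      |f (x, y) - f (x', y)| ≤ L * δ := by
    have h1 : dist x x' ≤ δ := by
      rw [dist_nndist, NNReal.coe_le_coe, ← ENNReal.coe_le_coe, ← edist_nndist]
      exact (Metric.edist_le_ediam_of_mem hx hx').trans hδ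
    have h2 := hf.dist_le_mul (x, y) (x', y)
    rw [Prod.dist_eq, dist_self, max_eq_left dist_nonneg, Real.dist_eq] at h2
    exact h2.trans (by gcongr)
  set x₀ := (data i₀).1
  have hx₀ : x₀ ∈ B.cell k := (BinPartition.mem_obs.1 hi₀).2
  have hψ : LipschitzWith L fun y => f (x₀, y) := by
    simpa [Function.comp_def] using hf.comp (LipschitzWith.prodMk_left x₀)
  have h1 := (Finset.univ : Finset (Fin (S.size k))).abs_average_sub_average_le
    (f := fun j => f (S.xstar k j, S.ystar k j)) (g := fun j => f (x₀, S.ystar k j))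
    (c := L * δ) (by positivity) fun j _ => by
      obtain ⟨i, hi, hx, -⟩ := S.coupled k j
      refine hcell ?_ hx₀ _
      rw [hx]
      exact (BinPartition.mem_obs.1 hi).2
  have h2 := (S.isSupportPoints k).abs_average_sub_average_le ⟨i₀, hi₀⟩ hm (fun i _ => hR i) hψ
  have h3 := (B.obs data N k).abs_average_sub_average_le
    (f := fun i => f (x₀, (data i).2)) (g := fun i => f (data i))
    (c := L * δ) (by positivity) fun i hi => hcell hx₀ (BinPartition.mem_obs.1 hi).2 _
  rw [Finset.card_univ, Fintype.card_fin] at h1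
  have h4 : (L : ℝ) * (R - -R) / (2 * S.size k) = L * R / S.size k := by
    have : (S.size k : ℝ) ≠ 0 := by exact_mod_cast hm.ne'
    field_simp
    ring
  rw [h4] at h2
  have h5 := abs_add_three
    ((∑ j, f (S.xstar k j, S.ystar k j)) / S.size k - (∑ j, f (x₀, S.ystar k j)) / S.size k)
    ((∑ j, f (x₀, S.ystar k j)) / S.size k
      - (∑ i ∈ B.obs data N k, f (x₀, (data i).2)) / (B.obs data N k).card)
    ((∑ i ∈ B.obs data N k, f (x₀, (data i).2)) / (B.obs data N k).card
      - (∑ i ∈ B.obs data N k, f (data i)) / (B.obs data N k).card)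
  rw [sub_add_sub_cancel, sub_add_sub_cancel] at h5
  linarith

open Classical in
/-- The contribution of one cell. The rounding of the cell size costs `1 / n`, which is at most
`(n_k / n) / M` as `M ≤ n_k`; observations in coarse cells cost `2 C` each. -/
theorem abs_sum_div_sub_sum_div_le (S : ConditionalSupportPoints B data N n) {M : ℕ} (hM : 0 < M)
    {k : Fin d → Fin κ} (hSM : (B.obs data N k).Nonempty → M ≤ S.size k) {δ R C : ℝ≥0}
    (hR : ∀ i, (data i).2 ∈ Set.Icc (-R : ℝ) R)
    {f : EuclideanSpace ℝ (Fin d) × ℝ → ℝ} (hC : ∀ p, |f p| ≤ C) {L : ℝ≥0}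
    (hf : LipschitzWith L f) :
    |(∑ j, f (S.xstar k j, S.ystar k j)) / n - (∑ i ∈ B.obs data N k, f (data i)) / N|
      ≤ C / M * (S.size k / n) + (∑ i ∈ B.obs data N k,
        ((2 * (L * δ) + L * R / M) + if (data i).1 ∈ B.coarse δ then 2 * (C : ℝ) else 0)) / N := by
  have hn : (0 : ℝ) < n := by exact_mod_cast n.pos
  have hN : (0 : ℝ) < N := by exact_mod_cast N.pos
  have hM' : (0 : ℝ) < M := by exact_mod_cast hM
  rcases (B.obs data N k).eq_empty_or_nonempty with he | hne
  · have h0 := S.size_eq_zero he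
    have : IsEmpty (Fin (S.size k)) := by rw [h0]; infer_instance
    simp [he, h0]
  have hsM := hSM hne
  have hm0 : 0 < S.size k := hM.trans_le hsM
  have hm : (0 : ℝ) < S.size k := by exact_mod_cast hm0
  have hT : (0 : ℝ) < (B.obs data N k).card := by exact_mod_cast hne.card_pos
  set a := (∑ j, f (S.xstar k j, S.ystar k j)) / S.size k with ha
  set b := (∑ i ∈ B.obs data N k, f (data i)) / (B.obs data N k).card with hb
  set m : ℝ := (S.size k : ℝ) with hm_def
  set T : ℝ := ((B.obs data N k).card : ℝ) with hT_def
  have ha' : |a| ≤ C := by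
    have := (Finset.univ : Finset (Fin (S.size k))).abs_average_le
      (f := fun j => f (S.xstar k j, S.ystar k j)) C.2 fun j _ => hC _
    rwa [Finset.card_univ, Fintype.card_fin] at this
  have hb' : |b| ≤ C := (B.obs data N k).abs_average_le C.2 fun i _ => hC _
  have hab : T * |a - b| ≤ ∑ i ∈ B.obs data N k,
      ((2 * (L * δ) + L * R / M) + if (data i).1 ∈ B.coarse δ then 2 * (C : ℝ) else 0) := by
    rw [hT_def, ← nsmul_eq_mul]
    refine Finset.card_nsmul_le_sum _ _ _ fun i hi => ?_
    have hi' := (BinPartition.mem_obs.1 hi).2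
    by_cases hk : Metric.ediam (B.cell k) ≤ δ
    · have h1 := S.abs_average_sub_average_le hne hm0 hk hR hf
      have h2 : (L : ℝ) * R / S.size k ≤ L * R / M := by
        gcongr
      have h3 : (0 : ℝ) ≤ if (data i).1 ∈ B.coarse δ then 2 * (C : ℝ) else 0 := by
        split_ifs <;> positivity
      linarith
    · rw [if_pos (B.mem_coarse hi' (not_le.1 hk))]
      have h1 : |a - b| ≤ |a| + |b| := abs_sub _ _
      have h2 : (0 : ℝ) ≤ 2 * (L * δ) + L * R / M := by positivity
      linarith
  have hsize : |m / n - T / N| ≤ 1 / M * (m / n) := by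
    have h1 := (S.size_proportional k).le
    have h2 : m / n - T / N = (m - n * T / N) / n := by field_simp
    have h3 : (1 : ℝ) ≤ 1 / M * m := by
      rw [one_div, inv_mul_eq_div, one_le_div hM']
      exact Nat.cast_le.2 hsM
    rw [h2, abs_div, abs_of_pos hn, ← mul_div_assoc]
    gcongr
    exact h1.trans h3
  have hsplit : (∑ j, f (S.xstar k j, S.ystar k j)) / n - (∑ i ∈ B.obs data N k, f (data i)) / N
      = (m / n - T / N) * a + T * (a - b) / N := by
    rw [ha, hb]
    field_simp
    ring
  rw [hsplit]
  refine (abs_add_le _ _).trans (add_le_add ?_ ?_)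
  · rw [abs_mul]
    calc |m / n - T / N| * |a| ≤ (1 / M * (m / n)) * C := by gcongr
      _ = C / M * (m / n) := by ring
  · rw [abs_div, abs_mul, abs_of_pos hT, abs_of_pos hN]
    gcongr

open Classical in
/-- The sum of the contributions of all cells: the rounding errors add up to `‖f‖ / M`. -/
theorem abs_integral_sub_average_le (S : ConditionalSupportPoints B data N n)
    (hdata : ∀ i, (data i).1 ∈ 𝒳) {M : ℕ} (hM : 0 < M)
    (hSM : ∀ k, (B.obs data N k).Nonempty → M ≤ S.size k) {δ R : ℝ≥0}
    (hR : ∀ i, (data i).2 ∈ Set.Icc (-R : ℝ) R)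
    (f : BoundedContinuousFunction (EuclideanSpace ℝ (Fin d) × ℝ) ℝ) {L : ℝ≥0}
    (hf : LipschitzWith L f) :
    |∫ p, f p ∂S.empiricalMeasure - (∑ i ∈ Finset.range N, f (data i)) / N|
      ≤ ‖f‖ / M + (2 * (L * δ) + L * R / M) + 2 * ‖f‖ *
        ((((Finset.range N).filter fun i => (data i).1 ∈ B.coarse δ).card : ℝ) / N) := by
  have hn : (0 : ℝ) < n := by exact_mod_cast n.pos
  have hN : (0 : ℝ) < N := by exact_mod_cast N.pos
  rw [S.integral_empiricalMeasure, ← B.sum_sum_obs hdata, Finset.sum_div, Finset.sum_div,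
    ← Finset.sum_sub_distrib]
  refine (Finset.abs_sum_le_sum_abs _ _).trans ((Finset.sum_le_sum fun k _ =>
    S.abs_sum_div_sub_sum_div_le (C := ‖f‖₊) (δ := δ) hM (hSM k) hR
      (fun p => by simpa using f.norm_coe_le_norm p) hf).trans_eq ?_)
  rw [Finset.sum_add_distrib, ← Finset.mul_sum, ← Finset.sum_div, ← Finset.sum_div,
    B.sum_sum_obs hdata, ← Nat.cast_sum, S.sum_size, div_self hn.ne', Finset.sum_add_distrib,
    Finset.sum_const, Finset.card_range, nsmul_eq_mul, ← Finset.sum_filter, Finset.sum_const,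
    nsmul_eq_mul, coe_nnnorm]
  field_simp
  ring

end ConditionalSupportPoints

/-! ### Weak convergence -/

open Classical in
/-- The deterministic part: a sample that is equidistributed with respect to `F` and of which only
a vanishing proportion falls into cells of diameter more than any given `δ` yields selected points
that converge weakly to `F`. -/
theorem ConditionalSupportPoints.tendsto_empiricalLaw {d : ℕ}
    {𝒳 : Set (EuclideanSpace ℝ (Fin d))} {F : ProbabilityMeasure (EuclideanSpace ℝ (Fin d) × ℝ)}
    {data : ℕ → EuclideanSpace ℝ (Fin d) × ℝ} {N : ℕ+ → ℕ+} {κ : ℕ+ → ℕ}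
    {B : ∀ n, BinPartition 𝒳 (κ n)} (hdata : ∀ i, (data i).1 ∈ 𝒳) {R : ℝ≥0}
    (hR : ∀ i, (data i).2 ∈ Set.Icc (-R : ℝ) R)
    (hconv : ∀ f : BoundedContinuousFunction (EuclideanSpace ℝ (Fin d) × ℝ) ℝ,
      Tendsto (fun n => (∑ i ∈ Finset.range (N n), f (data i)) / (N n : ℝ)) atTop
        (𝓝 (∫ p, f p ∂(F : Measure (EuclideanSpace ℝ (Fin d) × ℝ)))))
    (hcoarse : ∀ j : ℕ, Tendsto (fun n => (((Finset.range (N n)).filter fun i =>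
        (data i).1 ∈ (B n).coarse ((1 / (j + 1) : ℝ≥0) : ℝ≥0∞)).card : ℝ) / (N n : ℝ)) atTop (𝓝 0))
    (S : ∀ n, ConditionalSupportPoints (B n) data (N n) n)
    (hS : ∀ M : ℕ, ∀ᶠ n in atTop, ∀ k, ((B n).obs data (N n) k).Nonempty → M ≤ (S n).size k) :
    Tendsto (fun n => (S n).empiricalLaw) atTop (𝓝 F) := by
  rw [tendsto_iff_forall_lipschitz_integral_tendsto]
  rintro g ⟨C, hC⟩ ⟨L, hL⟩
  let f : BoundedContinuousFunction (EuclideanSpace ℝ (Fin d) × ℝ) ℝ := ⟨⟨g, hL.continuous⟩, C, hC⟩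
  have hL' : LipschitzWith L f := hL
  change Tendsto (fun n => ∫ p, f p ∂(S n).empiricalMeasure) atTop (𝓝 (∫ p, f p ∂(F : Measure _)))
  suffices h : Tendsto (fun n => ∫ p, f p ∂(S n).empiricalMeasure
      - (∑ i ∈ Finset.range (N n), f (data i)) / (N n : ℝ)) atTop (𝓝 0) by
    simpa using h.add (hconv f)
  rw [Metric.tendsto_nhds]
  intro ε hε
  obtain ⟨j, hj⟩ : ∃ j : ℕ, 2 * (L * (1 / ((j : ℝ) + 1))) < ε / 3 := by
    have h : Tendsto (fun j : ℕ => 2 * ((L : ℝ) * (1 / ((j : ℝ) + 1)))) atTop (𝓝 0) := by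
      simpa using (tendsto_one_div_add_atTop_nhds_zero_nat.const_mul (L : ℝ)).const_mul 2
    exact (h.eventually (gt_mem_nhds (by positivity))).exists
  obtain ⟨M, hM, hM0⟩ : ∃ M : ℕ, (‖f‖ + L * R) / M < ε / 3 ∧ 0 < M :=
    (((tendsto_const_div_atTop_nhds_zero_nat (‖f‖ + L * R)).eventually
      (gt_mem_nhds (by positivity))).and (eventually_gt_atTop 0)).exists
  have hcj : Tendsto (fun n => 2 * ‖f‖ * ((((Finset.range (N n)).filter fun i =>
        (data i).1 ∈ (B n).coarse ((1 / (j + 1) : ℝ≥0) : ℝ≥0∞)).card : ℝ) / (N n : ℝ)))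
          atTop (𝓝 0) := by
    simpa using (hcoarse j).const_mul (2 * ‖f‖)
  filter_upwards [hS M, hcj.eventually (gt_mem_nhds (show 0 < ε / 3 by positivity))] with n hn hc
  have h := (S n).abs_integral_sub_average_le hdata hM0 hn (δ := 1 / (j + 1)) hR f hL'
  rw [Real.dist_0_eq_abs]
  rw [add_div] at hM
  push_cast at h hj hc
  linarith

theorem mainTheorem2
    {d : ℕ}
    -- the covariate space and the response space
    (𝒳 : Set (EuclideanSpace ℝ (Fin d))) (h𝒳 : MeasurableSet 𝒳) (h𝒳_fin : volume 𝒳 < ⊤)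
    (𝒴 : Set ℝ) (h𝒴 : MeasurableSet 𝒴) (h𝒴_bdd : Bornology.IsBounded 𝒴)
    -- the joint law `F`, with marginal density `fX` and conditional density `fYX x y = f(y | x)`
    (F : ProbabilityMeasure (EuclideanSpace ℝ (Fin d) × ℝ))
    (fX : EuclideanSpace ℝ (Fin d) → ℝ≥0) (hfX : Measurable fX)
    (fYX : EuclideanSpace ℝ (Fin d) → ℝ → ℝ≥0) (hfYX : Measurable (Function.uncurry fYX))
    (hfYX_one : ∀ᵐ x ∂(volume.restrict 𝒳), ∫⁻ y in 𝒴, (fYX x y : ℝ≥0∞) = 1)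
    (hF : (F : Measure (EuclideanSpace ℝ (Fin d) × ℝ)) =
      ((volume.restrict 𝒳).prod (volume.restrict 𝒴)).withDensity
        (fun p => (fX p.1 : ℝ≥0∞) * (fYX p.1 p.2 : ℝ≥0∞)))
    -- `fX` is bounded away from zero and infinity
    (hfX_bdd : ∃ a b : ℝ≥0, 0 < a ∧ ∀ᵐ x ∂(volume.restrict 𝒳), a ≤ fX x ∧ fX x ≤ b)
    -- `fYX` is uniformly continuous in `x`, for almost every `y`
    (hfYX_cont : ∀ᵐ y ∂(volume.restrict 𝒴), UniformContinuousOn (fun x => fYX x y) 𝒳)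
    -- the independent observations `(x_i, y_i)` from `F`
    {Ω : Type*} [MeasurableSpace Ω] (P : Measure Ω) [IsProbabilityMeasure P]
    (data : ℕ → Ω → EuclideanSpace ℝ (Fin d) × ℝ)
    (hdata_law : ∀ i, HasLaw (data i) (F : Measure (EuclideanSpace ℝ (Fin d) × ℝ)) P)
    (hdata_indep : iIndepFun data P)
    -- the full sample size `N n`, for each number `n` of selected points
    (N : ℕ+ → ℕ+) (hN : Tendsto N atTop atTop)
    -- the partitions into `κ n ^ d` cells, and their refinement
    (κ : ℕ+ → ℕ) (B : ∀ n, BinPartition 𝒳 (κ n))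
    (hK : Tendsto (fun n => κ n ^ d) atTop atTop)
    (hB : ∀ᵐ x ∂(volume.restrict 𝒳),
      Tendsto (fun n => Metric.ediam ((B n).cellOf x)) atTop (𝓝 0)) :
    -- almost surely, whichever minimizers and nearest neighbours are selected
    ∀ᵐ ω ∂P, ∀ S : ∀ n, ConditionalSupportPoints (B n) (fun i => data i ω) (N n) n,
      -- if the number of points in the cells that contain observations tends to infinity
      (∀ M : ℕ, ∀ᶠ n in atTop, ∀ k,
        ((B n).obs (fun i => data i ω) (N n) k).Nonempty → M ≤ (S n).size k) →
      -- then `F_n` converges weakly to `F`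
      Tendsto (fun n => (S n).empiricalLaw) atTop (𝓝 F) := by
  obtain ⟨R₀, hR₀⟩ := h𝒴_bdd.subset_closedBall 0
  set R : ℝ≥0 := R₀.toNNReal
  have hF_ac : (F : Measure (EuclideanSpace ℝ (Fin d) × ℝ)) ≪
      (volume.restrict 𝒳).prod (volume.restrict 𝒴) := by
    rw [hF]
    exact withDensity_absolutelyContinuous _ _
  have hfst {p : EuclideanSpace ℝ (Fin d) → Prop} (hp : ∀ᵐ x ∂(volume.restrict 𝒳), p x) :
      ∀ᵐ z ∂(F : Measure (EuclideanSpace ℝ (Fin d) × ℝ)), p z.1 :=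
    hF_ac (Measure.quasiMeasurePreserving_fst.ae hp)
  have hsnd {p : ℝ → Prop} (hp : ∀ᵐ y ∂(volume.restrict 𝒴), p y) :
      ∀ᵐ z ∂(F : Measure (EuclideanSpace ℝ (Fin d) × ℝ)), p z.2 :=
    hF_ac (Measure.quasiMeasurePreserving_snd.ae hp)
  have hae {p : EuclideanSpace ℝ (Fin d) × ℝ → Prop}
      (hp : ∀ᵐ z ∂(F : Measure (EuclideanSpace ℝ (Fin d) × ℝ)), p z) :
      ∀ᵐ ω ∂P, ∀ i, p (data i ω) :=
    ae_all_iff.2 fun i => ae_of_ae_map (hdata_law i).aemeasurable (by rwa [(hdata_law i).map_eq])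
  have hN' : Tendsto (fun n => (N n : ℕ)) atTop atTop := by
    refine tendsto_atTop.2 fun b => ?_
    filter_upwards [hN.eventually_ge_atTop b.succPNat] with n hn
    have h1 : ((b.succPNat : ℕ+) : ℕ) ≤ N n := PNat.coe_le_coe _ _ |>.2 hn
    exact (Nat.le_succ b).trans h1
  have hcoarse (j : ℕ) := ae_tendsto_card_filter_div_zero hdata_law hdata_indep
    (A := fun n => Prod.fst ⁻¹' (B n).coarse ((1 / (j + 1) : ℝ≥0) : ℝ≥0∞))
    (fun n => measurable_fst ((B n).measurableSet_coarse h𝒳 _))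
    (hfst (p := fun x => ∀ᶠ n in atTop, x ∉ (B n).coarse ((1 / (j + 1) : ℝ≥0) : ℝ≥0∞)) (by
      filter_upwards [hB] with x hx
      have hpos : (0 : ℝ≥0∞) < ((1 / (j + 1) : ℝ≥0) : ℝ≥0∞) := by
        rw [ENNReal.coe_pos]; positivity
      filter_upwards [hx.eventually (gt_mem_nhds hpos)] with n hn hmem
      exact hn.not_gt ((B n).lt_ediam_of_mem_coarse hmem))) hN'
  filter_upwards [ae_forall_tendsto_average F hdata_law hdata_indep, ae_all_iff.2 hcoarse,
    hae (hfst (ae_restrict_mem h𝒳)), hae (hsnd (ae_restrict_mem h𝒴))] with ω hω hωc hωx hωy S hS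
  refine ConditionalSupportPoints.tendsto_empiricalLaw (R := R) hωx (fun i => ?_)
    (fun f => (hω f).comp hN') hωc S hS
  have h := hR₀ (hωy i)
  rw [mem_closedBall_zero_iff, Real.norm_eq_abs, abs_le] at h
  exact ⟨(neg_le_neg (Real.le_coe_toNNReal _)).trans h.1, h.2.trans (Real.le_coe_toNNReal _)⟩
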